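/- For $\theta\in\mathbb{R}$ let $A_\theta$ be the rotation $C^*$-algebra, i.e. the universal unital $C^*$-algebra generated by two unitaries $U,V$ subject to $UV=e^{2\pi i\theta}VU$, and for $\lambda\in\mathbb{R}$ let $$H_{\theta,\lambda}=U+U^*+\frac{\lambda}{2}(V+V^*)\in A_\theta .$$ Then for every $\lambda\in\mathbb{R}$: (i) for every $\theta\in[1/4,1/2]$, $\ \|H_{\theta,\lambda}\|\le\sqrt{4+\lambda^2}$; (ii) for every $\theta\in[0,1/4]$, $\ \|H_{\theta,\lambda}\|^2\le 4+\lambda^2+4|\lambda|(\cos\pi\theta-\sin\pi\theta)\cos\pi\theta$. -/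

import Mathlib

/-- `u` and `v` are unitaries of the unital C⋆-algebra `B` with `u v = e^{2πiθ} v u`. -/
structure IsRotationPair (θ : ℝ) {B : Type*} [CStarAlgebra B] (u v : B) : Prop where
  left_mem_unitary : u ∈ unitary B
  right_mem_unitary : v ∈ unitary B
  mul_eq : u * v = Complex.exp (2 * Real.pi * Complex.I * θ) • (v * u)

/-- A nonzero unital C⋆-algebra together with a pair of unitaries satisfying the
rotation relation with angle `θ`. -/
structure RotationModel (θ : ℝ) : Type 1 where
  carrier : Type
  [cstar : CStarAlgebra carrier]
  [nontriv : Nontrivial carrier]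
  u : carrier
  v : carrier
  isRotationPair : IsRotationPair θ u v

attribute [instance] RotationModel.cstar RotationModel.nontriv

namespace RotationAlgebra

/-- The C⋆-algebra of bounded families indexed by all models of the rotation relation. -/
abbrev Ambient (θ : ℝ) : Type 1 :=
  lp (fun m : RotationModel θ => m.carrier) ⊤

noncomputable instance ambientCStarAlgebra (θ : ℝ) : CStarAlgebra (Ambient θ) where

/-- The family of all `u`'s. -/
noncomputable def ambientU (θ : ℝ) : Ambient θ :=
  ⟨fun m => m.u, memℓp_infty ⟨1, by
    rintro _ ⟨m, rfl⟩
    exact (CStarRing.norm_of_mem_unitary m.isRotationPair.left_mem_unitary).le⟩⟩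

/-- The family of all `v`'s. -/
noncomputable def ambientV (θ : ℝ) : Ambient θ :=
  ⟨fun m => m.v, memℓp_infty ⟨1, by
    rintro _ ⟨m, rfl⟩
    exact (CStarRing.norm_of_mem_unitary m.isRotationPair.right_mem_unitary).le⟩⟩

/-- The closed unital ⋆-subalgebra generated by the two universal unitaries. -/
noncomputable def generated (θ : ℝ) : StarSubalgebra ℂ (Ambient θ) :=
  (StarAlgebra.adjoin ℂ {ambientU θ, ambientV θ}).topologicalClosure

instance isClosed_generated (θ : ℝ) : IsClosed (generated θ : Set (Ambient θ)) :=
  StarSubalgebra.isClosed_topologicalClosure _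

end RotationAlgebra

open RotationAlgebra in
/-- The rotation C⋆-algebra `A_θ = C⋆(U, V unitaries; UV = e^{2πiθ} VU)`, the universal unital
C⋆-algebra generated by two unitaries satisfying the rotation relation. It is realized as the closed
⋆-subalgebra generated by the families of all `u`'s and all `v`'s in the product of all models;
`RotationAlgebra.existsUnique_starAlgHom` is its universal property. -/
def RotationAlgebra (θ : ℝ) : Type 1 := generated θ

namespace RotationAlgebra

noncomputable instance instCStarAlgebra (θ : ℝ) : CStarAlgebra (RotationAlgebra θ) :=
  StarSubalgebra.cstarAlgebra (generated θ)

/-- The canonical unitary `U` of `A_θ`. -/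
noncomputable def U (θ : ℝ) : RotationAlgebra θ :=
  ⟨ambientU θ, StarSubalgebra.le_topologicalClosure _
    (StarAlgebra.subset_adjoin ℂ _ (by simp))⟩

/-- The canonical unitary `V` of `A_θ`. -/
noncomputable def V (θ : ℝ) : RotationAlgebra θ :=
  ⟨ambientV θ, StarSubalgebra.le_topologicalClosure _
    (StarAlgebra.subset_adjoin ℂ _ (by simp))⟩

theorem isRotationPair_U_V (θ : ℝ) : IsRotationPair θ (U θ) (V θ) := by
  refine ⟨?_, ?_, ?_⟩
  · rw [Unitary.mem_iff]
    constructor <;> refine Subtype.ext (lp.ext (funext fun m => ?_))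
    · exact (Unitary.mem_iff.1 m.isRotationPair.left_mem_unitary).1
    · exact (Unitary.mem_iff.1 m.isRotationPair.left_mem_unitary).2
  · rw [Unitary.mem_iff]
    constructor <;> refine Subtype.ext (lp.ext (funext fun m => ?_))
    · exact (Unitary.mem_iff.1 m.isRotationPair.right_mem_unitary).1
    · exact (Unitary.mem_iff.1 m.isRotationPair.right_mem_unitary).2
  · refine Subtype.ext (lp.ext (funext fun m => ?_))
    exact m.isRotationPair.mul_eq

/-- The coordinate projection of `A_θ` onto a model. -/
noncomputable def eval {θ : ℝ} (m : RotationModel θ) : RotationAlgebra θ →⋆ₐ[ℂ] m.carrier where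
  toFun x := x.1 m
  map_one' := rfl
  map_mul' _ _ := rfl
  map_zero' := rfl
  map_add' _ _ := rfl
  commutes' _ := rfl
  map_star' _ := rfl

theorem small_closure_adjoin {B : Type*} [CStarAlgebra B] (u v : B) :
    Small.{0} (StarAlgebra.adjoin ℂ {u, v}).topologicalClosure := by
  have h1 : Small.{0} (StarAlgebra.adjoin ℂ ({u, v} : Set B)) := by
    let f : FreeAlgebra ℂ (Fin 4) →ₐ[ℂ] B := FreeAlgebra.lift ℂ ![u, v, star u, star v]
    have hle : (StarAlgebra.adjoin ℂ ({u, v} : Set B)).toSubalgebra ≤ f.range := by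
      rw [StarAlgebra.adjoin_toSubalgebra]
      refine Algebra.adjoin_le ?_
      have hmem (i : Fin 4) : ![u, v, star u, star v] i ∈ f.range :=
        ⟨FreeAlgebra.ι ℂ i, by simp [f]⟩
      rintro x (hx | hx)
      · rcases hx with rfl | rfl
        · exact hmem 0
        · exact hmem 1
      · rcases hx with hx | hx
        · rw [← star_star x, hx]; exact hmem 2
        · rw [← star_star x, hx]; exact hmem 3
    have : Small.{0} f.range :=
      small_of_surjective (f := fun a : FreeAlgebra ℂ (Fin 4) => (⟨f a, a, rfl⟩ : f.range))
        (by rintro ⟨_, a, rfl⟩; exact ⟨a, rfl⟩)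
    exact small_of_injective
      (f := fun x : StarAlgebra.adjoin ℂ ({u, v} : Set B) => (⟨x.1, hle x.2⟩ : f.range))
      (fun x y h => Subtype.ext (congrArg (fun z : f.range => (z : B)) h))
  let S := StarAlgebra.adjoin ℂ ({u, v} : Set B)
  have hseq (x : S.topologicalClosure) :
      ∃ s : ℕ → S, Filter.Tendsto (fun n => (s n : B)) Filter.atTop (nhds (x : B)) := by
    obtain ⟨s, hs, hlim⟩ := mem_closure_iff_seq_limit.1 (show (x : B) ∈ closure (S : Set B) from x.2)
    exact ⟨fun n => ⟨s n, hs n⟩, hlim⟩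
  choose s hs using hseq
  exact small_of_injective (f := s)
    (fun x y h => Subtype.ext (tendsto_nhds_unique (hs x) (h ▸ hs y)))

/-- A unital C⋆-algebra whose type is small is ⋆-isomorphic to one in the lowest universe. -/
theorem exists_model_of_small {C : Type*} [CStarAlgebra C] [Small.{0} C] :
    ∃ (D : Type) (_ : CStarAlgebra D), Nonempty (D ≃⋆ₐ[ℂ] C) := by
  let e : Shrink.{0} C ≃ C := (equivShrink C).symm
  let r : Ring (Shrink.{0} C) := e.ring
  let a : Algebra ℂ (Shrink.{0} C) := e.algebra ℂ
  let f : Shrink.{0} C ≃ₐ[ℂ] C := e.algEquiv ℂ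
  let nr : NormedRing (Shrink.{0} C) := NormedRing.induced _ _ f f.injective
  let na : NormedAlgebra ℂ (Shrink.{0} C) := NormedAlgebra.induced _ _ _ f
  let st : StarRing (Shrink.{0} C) :=
    { star := fun x => f.symm (star (f x))
      star_involutive := fun x => by simp
      star_mul := fun x y => by simp
      star_add := fun x y => by simp }
  have hstar (x : Shrink.{0} C) : f (star x) = star (f x) := f.apply_symm_apply _
  have hiso : Isometry f := AddMonoidHomClass.isometry_of_norm f fun _ => rfl
  have hc : CompleteSpace (Shrink.{0} C) :=
    (hiso.isUniformInducing.completeSpace_congr f.surjective).2 inferInstance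
  have hcs : CStarRing (Shrink.{0} C) :=
    ⟨fun x => by
      have h := CStarRing.norm_mul_self_le (f x)
      rw [← hstar, ← map_mul] at h
      exact h⟩
  have hsm : StarModule ℂ (Shrink.{0} C) :=
    ⟨fun z x => f.injective (by rw [hstar, map_smul, star_smul, map_smul, hstar])⟩
  exact ⟨Shrink.{0} C, { nr, na, st, hc, hcs, hsm with }, ⟨StarAlgEquiv.ofAlgEquiv f hstar⟩⟩

/-- Universal property of `A_θ`, for unital C⋆-algebras in every universe. -/
theorem existsUnique_starAlgHom {θ : ℝ} {B : Type*} [CStarAlgebra B] {u v : B}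
    (h : IsRotationPair θ u v) :
    ∃! φ : RotationAlgebra θ →⋆ₐ[ℂ] B, φ (U θ) = u ∧ φ (V θ) = v := by
  refine existsUnique_of_exists_of_unique ?_ ?_
  · rcases subsingleton_or_nontrivial B with hB | hB
    · let φ : RotationAlgebra θ →⋆ₐ[ℂ] B :=
        { toFun := fun _ => 0
          map_one' := Subsingleton.elim _ _
          map_mul' := fun _ _ => Subsingleton.elim _ _
          map_zero' := rfl
          map_add' := fun _ _ => Subsingleton.elim _ _
          commutes' := fun _ => Subsingleton.elim _ _
          map_star' := fun _ => Subsingleton.elim _ _ }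
      exact ⟨φ, Subsingleton.elim _ _, Subsingleton.elim _ _⟩
    · let S := (StarAlgebra.adjoin ℂ ({u, v} : Set B)).topologicalClosure
      have hSc : IsClosed (S : Set B) := StarSubalgebra.isClosed_topologicalClosure _
      let cS : CStarAlgebra S := StarSubalgebra.cstarAlgebra S
      have hS : Small.{0} S := small_closure_adjoin u v
      have hu : u ∈ S := StarSubalgebra.le_topologicalClosure _
        (StarAlgebra.subset_adjoin ℂ _ (by simp))
      have hv : v ∈ S := StarSubalgebra.le_topologicalClosure _
        (StarAlgebra.subset_adjoin ℂ _ (by simp))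
      obtain ⟨D, cD, ⟨e⟩⟩ := exists_model_of_small (C := S)
      have hD : Nontrivial D := e.symm.injective.nontrivial
      have hpair : IsRotationPair θ (⟨u, hu⟩ : S) ⟨v, hv⟩ := by
        refine ⟨Unitary.mem_iff.2 ⟨?_, ?_⟩, Unitary.mem_iff.2 ⟨?_, ?_⟩, ?_⟩ <;>
          refine Subtype.ext ?_
        · exact (Unitary.mem_iff.1 h.left_mem_unitary).1
        · exact (Unitary.mem_iff.1 h.left_mem_unitary).2
        · exact (Unitary.mem_iff.1 h.right_mem_unitary).1
        · exact (Unitary.mem_iff.1 h.right_mem_unitary).2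
        · exact h.mul_eq
      have hpair' : IsRotationPair θ (e.symm ⟨u, hu⟩) (e.symm ⟨v, hv⟩) := by
        refine ⟨Unitary.map_mem e.symm hpair.left_mem_unitary,
          Unitary.map_mem e.symm hpair.right_mem_unitary, ?_⟩
        rw [← map_mul, hpair.mul_eq, map_smul, map_mul]
      let m : RotationModel θ := { carrier := D, u := _, v := _, isRotationPair := hpair' }
      refine ⟨S.subtype.comp ((e : D →⋆ₐ[ℂ] S).comp (eval m)), ?_, ?_⟩
      · exact congrArg Subtype.val (e.apply_symm_apply ⟨u, hu⟩)
      · exact congrArg Subtype.val (e.apply_symm_apply ⟨v, hv⟩)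
  · rintro φ ψ ⟨hφu, hφv⟩ ⟨hψu, hψv⟩
    have hφ : Continuous φ :=
      AddMonoidHomClass.continuous_of_bound φ 1 fun x => by
        simpa using NonUnitalStarAlgHom.norm_apply_le φ x
    have hψ : Continuous ψ :=
      AddMonoidHomClass.continuous_of_bound ψ 1 fun x => by
        simpa using NonUnitalStarAlgHom.norm_apply_le ψ x
    refine StarAlgHom.ext_topologicalClosure hφ hψ ?_
    refine StarAlgHom.ext_adjoin ?_
    rintro ⟨x, hx⟩ (rfl | rfl)
    · exact hφu.trans hψu.symm
    · exact hφv.trans hψv.symm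

end RotationAlgebra

/-- The element `H_{θ,lam} = U + U⋆ + (lam/2)(V + V⋆)` of the rotation C⋆-algebra `A_θ`. -/
noncomputable def almostMathieu (θ lam : ℝ) : RotationAlgebra θ :=
  RotationAlgebra.U θ + star (RotationAlgebra.U θ) +
    ((lam / 2 : ℝ) : ℂ) • (RotationAlgebra.V θ + star (RotationAlgebra.V θ))

/-! Write m = λ/2, s = `twoIm u`, t = `twoIm v`, C = `cross θ u v`. Two identities carry the proof:
H² = 4 + 4m² - s² - m²t² + 2m cos(πθ) C (`hamiltonian_mul_self`), and, for x = s + imt, xx* = s² +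
m²t² - 2m sin(πθ) C (`twoIm_mul_conj`). The same cross term C occurs in both, so positivity of xx*
controls it. On [1/4, 1/2], cos = c sin with 0 ≤ c ≤ 1, and 4 + 4m² - H² = c xx* + (1 - c)(s² +
m²t²) ≥ 0. On [0, 1/4], 4 + 4m² - H² = xx* - 2m(cos - sin) C, so a bound on ‖C‖ remains to be found.
C is itself a Hamiltonian with m = 1 at angle 2θ (`weyl_pair`, `cross_eq`); the crude estimate there
gives ‖C‖ ≤ 4 cos(πθ) (`norm_cross_le`). -/

/-! ### Algebraic identities in the rotation relation -/

section Identities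

variable {A : Type*} [Ring A] [Algebra ℂ A] {u u' v v' : A} {w w' : ℂ}

/-- Expansion of `(u + u' + m (v + v'))²`, where `u' = u⁻¹`, `v' = v⁻¹` and `v u = w⁻² u v`. -/
theorem hamiltonian_sq_eq (hu : u * u' = 1) (hu' : u' * u = 1) (hv : v * v' = 1)
    (hv' : v' * v = 1) (h1 : v * u = w' ^ 2 • (u * v)) (h2 : v * u' = w ^ 2 • (u' * v))
    (h3 : v' * u = w ^ 2 • (u * v')) (h4 : v' * u' = w' ^ 2 • (u' * v'))
    (hw : w * w' = 1) (m : ℂ) :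
    (u + u' + m • (v + v')) * (u + u' + m • (v + v')) =
      (4 + 4 * m ^ 2) • (1 : A) - (-Complex.I • (u - u')) * (-Complex.I • (u - u'))
      - m ^ 2 • ((-Complex.I • (v - v')) * (-Complex.I • (v - v')))
      + (m * (w + w')) • (w' • (u * v) + w • (u * v') + w • (u' * v) + w' • (u' * v')) := by
  -- All words are put in the order u before v; the coefficients then agree by ww' = 1 and i² = -1.
  simp only [mul_add, add_mul, mul_sub, sub_mul, smul_mul_assoc, mul_smul_comm, hu, hu', hv, hv',
    h1, h2, h3, h4, smul_add, smul_sub]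
  match_scalars <;> grind [Complex.I_sq]

/-- Expansion of `(s + i m t) (s - i m t)` with `s = -i (u - u')` and `t = -i (v - v')`. -/
theorem mul_conj_eq (h1 : v * u = w' ^ 2 • (u * v)) (h2 : v * u' = w ^ 2 • (u' * v))
    (h3 : v' * u = w ^ 2 • (u * v')) (h4 : v' * u' = w' ^ 2 • (u' * v'))
    (hw : w * w' = 1) (m : ℂ) :
    (-Complex.I • (u - u') + (Complex.I * m) • (-Complex.I • (v - v'))) *
        (-Complex.I • (u - u') - (Complex.I * m) • (-Complex.I • (v - v'))) =
      (-Complex.I • (u - u')) * (-Complex.I • (u - u'))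
      + m ^ 2 • ((-Complex.I • (v - v')) * (-Complex.I • (v - v')))
      - (Complex.I * m * (w' - w)) •
        (w' • (u * v) + w • (u * v') + w • (u' * v) + w' • (u' * v')) := by
  simp only [add_mul, mul_sub, sub_mul, smul_mul_assoc, mul_smul_comm,
    h1, h2, h3, h4, smul_add, smul_sub]
  match_scalars <;> grind [Complex.I_sq]

end Identities

/-! ### Phases and commutation relations -/

namespace IsRotationPair

variable {B : Type*} [CStarAlgebra B]

/-- The phase `e^{iπθ}`. -/
noncomputable def phase (θ : ℝ) : ℂ := Complex.exp (Real.pi * θ * Complex.I)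

theorem star_phase (θ : ℝ) : star (phase θ) = Complex.exp (-(Real.pi * θ * Complex.I)) := by
  simp [phase, ← Complex.exp_conj]

theorem phase_mul_star (θ : ℝ) : phase θ * star (phase θ) = 1 := by
  rw [star_phase, phase, ← Complex.exp_add]; simp

theorem phase_add_star (θ : ℝ) :
    phase θ + star (phase θ) = ((2 * Real.cos (Real.pi * θ) : ℝ) : ℂ) := by
  rw [star_phase, phase]; push_cast; rw [Complex.two_cos]; ring_nf

theorem star_phase_sub (θ : ℝ) :
    Complex.I * (star (phase θ) - phase θ) = ((2 * Real.sin (Real.pi * θ) : ℝ) : ℂ) := by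
  rw [star_phase, phase]; push_cast; rw [Complex.two_sin]; ring_nf

/-- The sum of the four Weyl-ordered products `U^{±1} V^{±1}`. -/
noncomputable def cross (θ : ℝ) (u v : B) : B :=
  star (phase θ) • (u * v) + phase θ • (u * star v) + phase θ • (star u * v) +
    star (phase θ) • (star u * star v)

/-- Twice the imaginary part of `u`. -/
noncomputable def twoIm (u : B) : B := -Complex.I • (u - star u)

theorem star_twoIm (u : B) : star (twoIm u) = twoIm u := by
  simp [twoIm, star_smul]
  module

variable {θ : ℝ} {u v : B}

theorem mul_star_left (h : IsRotationPair θ u v) : u * star u = 1 :=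
  (Unitary.mem_iff.1 h.left_mem_unitary).2

theorem star_mul_left (h : IsRotationPair θ u v) : star u * u = 1 :=
  (Unitary.mem_iff.1 h.left_mem_unitary).1

theorem mul_star_right (h : IsRotationPair θ u v) : v * star v = 1 :=
  (Unitary.mem_iff.1 h.right_mem_unitary).2

theorem star_mul_right (h : IsRotationPair θ u v) : star v * v = 1 :=
  (Unitary.mem_iff.1 h.right_mem_unitary).1

theorem mul_eq_phase (h : IsRotationPair θ u v) : u * v = phase θ ^ 2 • (v * u) := by
  rw [h.mul_eq, phase, ← Complex.exp_nat_mul]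
  congr 2
  push_cast
  ring

theorem star_phase_sq_mul (θ : ℝ) : star (phase θ) ^ 2 * phase θ ^ 2 = 1 := by
  rw [← mul_pow, mul_comm, phase_mul_star, one_pow]

theorem right_mul_left (h : IsRotationPair θ u v) :
    v * u = star (phase θ) ^ 2 • (u * v) := by
  rw [h.mul_eq_phase, smul_smul, star_phase_sq_mul, one_smul]

theorem right_mul_star_left (h : IsRotationPair θ u v) :
    v * star u = phase θ ^ 2 • (star u * v) := by
  calc v * star u = star u * (u * v) * star u := by
        rw [← mul_assoc, h.star_mul_left, one_mul]
    _ = phase θ ^ 2 • (star u * v) := by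
        rw [h.mul_eq_phase, mul_smul_comm, smul_mul_assoc, mul_assoc, mul_assoc, h.mul_star_left,
          mul_one]

theorem star_right_mul_left (h : IsRotationPair θ u v) :
    star v * u = phase θ ^ 2 • (u * star v) := by
  calc star v * u = star v * (u * v) * star v := by
        rw [mul_assoc, mul_assoc, h.mul_star_right, mul_one]
    _ = phase θ ^ 2 • (u * star v) := by
        rw [h.mul_eq_phase, mul_smul_comm, smul_mul_assoc, ← mul_assoc, h.star_mul_right, one_mul]

theorem star_right_mul_star_left (h : IsRotationPair θ u v) :
    star v * star u = star (phase θ) ^ 2 • (star u * star v) := by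
  rw [← star_mul, h.mul_eq_phase, star_smul, star_mul, star_pow]

theorem hamiltonian_mul_self (h : IsRotationPair θ u v) (m : ℝ) :
    (u + star u + (m : ℂ) • (v + star v)) * (u + star u + (m : ℂ) • (v + star v)) =
      (4 + 4 * (m : ℂ) ^ 2) • (1 : B) - twoIm u * twoIm u - (m : ℂ) ^ 2 • (twoIm v * twoIm v)
      + (m * ((2 * Real.cos (Real.pi * θ) : ℝ) : ℂ)) • cross θ u v := by
  rw [← phase_add_star]
  exact hamiltonian_sq_eq h.mul_star_left h.star_mul_left h.mul_star_right h.star_mul_right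
    h.right_mul_left h.right_mul_star_left h.star_right_mul_left h.star_right_mul_star_left
    (phase_mul_star θ) m

theorem twoIm_mul_conj (h : IsRotationPair θ u v) (m : ℝ) :
    (twoIm u + (Complex.I * m) • twoIm v) * (twoIm u - (Complex.I * m) • twoIm v) =
      twoIm u * twoIm u + (m : ℂ) ^ 2 • (twoIm v * twoIm v)
      - (m * ((2 * Real.sin (Real.pi * θ) : ℝ) : ℂ)) • cross θ u v := by
  rw [← star_phase_sub, ← mul_assoc, mul_comm (m : ℂ)]
  exact mul_conj_eq h.right_mul_left h.right_mul_star_left h.star_right_mul_left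
    h.star_right_mul_star_left (phase_mul_star θ) m

/-! ### The cross term as a Hamiltonian at the doubled angle -/

theorem star_phase_smul_mul_mem_unitary (h : IsRotationPair θ u v) :
    star (phase θ) • (u * v) ∈ unitary B := by
  have hw : star (phase θ) ∈ unitary ℂ := by
    rw [Unitary.mem_iff]; simp only [star_star]
    exact ⟨phase_mul_star θ, by rw [mul_comm, phase_mul_star]⟩
  exact Unitary.smul_mem_of_mem hw (mul_mem h.left_mem_unitary h.right_mem_unitary)

theorem phase_smul_mul_star_mem_unitary (h : IsRotationPair θ u v) :
    phase θ • (u * star v) ∈ unitary B := by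
  have hw : phase θ ∈ unitary ℂ := by
    rw [Unitary.mem_iff]
    exact ⟨by rw [mul_comm, phase_mul_star], phase_mul_star θ⟩
  exact Unitary.smul_mem_of_mem hw
    (mul_mem h.left_mem_unitary (Unitary.star_mem h.right_mem_unitary))

/-- Both uv*·uv and uv·uv* are multiples of u², and their ratio is the fourth power of `phase θ`,
which doubles the angle. The phase factors make the pair sum to `cross θ u v`. -/
theorem weyl_pair (h : IsRotationPair θ u v) :
    IsRotationPair (2 * θ) (phase θ • (u * star v)) (star (phase θ) • (u * v)) := by
  refine ⟨h.phase_smul_mul_star_mem_unitary, h.star_phase_smul_mul_mem_unitary, ?_⟩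
  have e : Complex.exp (2 * Real.pi * Complex.I * (2 * θ : ℝ)) = phase θ ^ 4 := by
    rw [phase, ← Complex.exp_nat_mul]
    congr 1
    push_cast
    ring
  have h1 : u * star v * (u * v) = phase θ ^ 2 • (u * u) := by
    rw [mul_assoc, ← mul_assoc (star v), h.star_right_mul_left, smul_mul_assoc, mul_assoc u,
      h.star_mul_right, mul_one, mul_smul_comm]
  have h2 : u * v * (u * star v) = star (phase θ) ^ 2 • (u * u) := by
    rw [mul_assoc, ← mul_assoc v, h.right_mul_left, smul_mul_assoc, mul_assoc u, h.mul_star_right,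
      mul_one, mul_smul_comm]
  rw [e]
  simp only [smul_mul_assoc, mul_smul_comm, h1, h2]
  match_scalars
  have := phase_mul_star θ
  grind

theorem cross_eq (h : IsRotationPair θ u v) :
    cross θ u v = phase θ • (u * star v) + star (phase θ • (u * star v)) +
      ((1 : ℝ) : ℂ) • (star (phase θ) • (u * v) + star (star (phase θ) • (u * v))) := by
  simp only [cross, star_smul, star_mul, star_star, h.right_mul_star_left,
    h.star_right_mul_star_left, Complex.ofReal_one, one_smul]
  have := phase_mul_star θ
  match_scalars <;> grind

theorem star_cross (h : IsRotationPair θ u v) : star (cross θ u v) = cross θ u v := by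
  rw [h.cross_eq]
  simp only [star_add, star_star, Complex.ofReal_one, one_smul]
  abel

theorem norm_le_one_of_mem_unitary {x : B} (hx : x ∈ unitary B) : ‖x‖ ≤ 1 := by
  rcases subsingleton_or_nontrivial B with hB | hB
  · simp [Subsingleton.elim x 0]
  · exact (CStarRing.norm_of_mem_unitary hx).le

theorem norm_cross_le_four (h : IsRotationPair θ u v) : ‖cross θ u v‖ ≤ 4 := by
  have h1 := norm_le_one_of_mem_unitary h.phase_smul_mul_star_mem_unitary
  have h2 := norm_le_one_of_mem_unitary h.star_phase_smul_mul_mem_unitary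
  rw [h.cross_eq, Complex.ofReal_one, one_smul]
  refine (norm_add_le_of_le (norm_add_le_of_le h1 ((norm_star _).trans_le h1))
    (norm_add_le_of_le h2 ((norm_star _).trans_le h2))).trans (by norm_num)

theorem star_hamiltonian (u v : B) (m : ℝ) :
    star (u + star u + (m : ℂ) • (v + star v)) = u + star u + (m : ℂ) • (v + star v) := by
  simp only [star_add, star_smul, star_star, Complex.star_def, Complex.conj_ofReal,
    add_comm (star u), add_comm (star v)]

/-! ### Positivity and norm bounds -/

section Order

variable [PartialOrder B] [StarOrderedRing B]

theorem twoIm_mul_self_nonneg (u : B) : 0 ≤ twoIm u * twoIm u := by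
  simpa only [star_twoIm] using star_mul_self_nonneg (twoIm u)

theorem twoIm_mul_conj_nonneg (u v : B) (m : ℝ) :
    0 ≤ (twoIm u + (Complex.I * m) • twoIm v) * (twoIm u - (Complex.I * m) • twoIm v) := by
  have e : twoIm u - (Complex.I * m) • twoIm v = star (twoIm u + (Complex.I * m) • twoIm v) := by
    simp only [star_add, star_smul, star_twoIm]
    simp [sub_eq_add_neg]
  rw [e]
  exact mul_star_self_nonneg _

theorem ofReal_smul_nonneg {r : ℝ} (hr : 0 ≤ r) {x : B} (hx : 0 ≤ x) : 0 ≤ (r : ℂ) • x := by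
  rw [Complex.coe_smul]
  exact smul_nonneg hr hx

/-- By the C⋆-identity ‖x‖² = ‖x²‖, and a positive element has norm at most r iff it lies below r·1.
-/
theorem norm_sq_le_of_nonneg {x : B} (hx : star x = x) {r : ℝ} (hr : 0 ≤ r)
    (h : 0 ≤ (r : ℂ) • (1 : B) - x * x) : ‖x‖ ^ 2 ≤ r := by
  have h0 : 0 ≤ x * x := by simpa only [hx] using star_mul_self_nonneg x
  have e : ‖x‖ ^ 2 = ‖x * x‖ := by
    rw [sq, ← CStarRing.norm_star_mul_self (x := x), hx]
  rw [e, CStarAlgebra.norm_le_iff_le_algebraMap _ hr h0, Algebra.algebraMap_eq_smul_one, ← Complex.coe_smul]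
  exact sub_nonneg.1 h

theorem smul_cross_le (h : IsRotationPair θ u v) {k : ℝ} (hk : ‖cross θ u v‖ ≤ k) (m : ℝ) :
    (m : ℂ) • cross θ u v ≤ ((|m| * k : ℝ) : ℂ) • (1 : B) := by
  have hs : IsSelfAdjoint ((m : ℂ) • cross θ u v) := by
    rw [IsSelfAdjoint, star_smul, h.star_cross]; simp
  refine hs.le_algebraMap_norm_self.trans ?_
  rw [Complex.coe_smul, ← Algebra.algebraMap_eq_smul_one]
  refine algebraMap_mono B ?_
  rw [norm_smul]
  rw [Real.norm_eq_abs]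
  exact mul_le_mul_of_nonneg_left hk (abs_nonneg m)

/-- Crude estimate at m = 1: drop -s² - t² from H² and use ‖C‖ ≤ 4. It is meant for the Weyl pair at
angle 2θ. -/
theorem norm_sq_le_of_cos_nonneg (h : IsRotationPair θ u v)
    (hc : 0 ≤ Real.cos (Real.pi * θ)) :
    ‖u + star u + ((1 : ℝ) : ℂ) • (v + star v)‖ ^ 2 ≤ 8 + 8 * Real.cos (Real.pi * θ) := by
  refine norm_sq_le_of_nonneg (star_hamiltonian u v 1) (by positivity) ?_
  rw [h.hamiltonian_mul_self]
  have h1 := ofReal_smul_nonneg (r := 2 * Real.cos (Real.pi * θ)) (by positivity)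
    (sub_nonneg.2 (h.smul_cross_le h.norm_cross_le_four 1))
  rw [abs_one] at h1
  have h2 := add_nonneg (add_nonneg (twoIm_mul_self_nonneg u) (twoIm_mul_self_nonneg v)) h1
  convert h2 using 1
  match_scalars <;> ring

theorem norm_cross_le (h : IsRotationPair θ u v) (hθ : θ ∈ Set.Icc (0 : ℝ) (1 / 4)) :
    ‖cross θ u v‖ ≤ 4 * Real.cos (Real.pi * θ) := by
  have hc : 0 ≤ Real.cos (Real.pi * θ) :=
    Real.cos_nonneg_of_mem_Icc ⟨by nlinarith [Real.pi_pos, hθ.1], by nlinarith [Real.pi_pos, hθ.2]⟩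
  have hc2 : 0 ≤ Real.cos (Real.pi * (2 * θ)) :=
    Real.cos_nonneg_of_mem_Icc ⟨by nlinarith [Real.pi_pos, hθ.1], by nlinarith [Real.pi_pos, hθ.2]⟩
  have := h.weyl_pair.norm_sq_le_of_cos_nonneg hc2
  -- The bound becomes a square: 8 + 8 cos(2πθ) = (4 cos(πθ))².
  rw [← h.cross_eq, show Real.pi * (2 * θ) = 2 * (Real.pi * θ) by ring, Real.cos_two_mul] at this
  exact (sq_le_sq₀ (norm_nonneg _) (by positivity)).1 (by linarith)

theorem norm_sq_le_of_mem_Icc_quarter_half (h : IsRotationPair θ u v)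
    (hθ : θ ∈ Set.Icc (1 / 4 : ℝ) (1 / 2)) (m : ℝ) :
    ‖u + star u + (m : ℂ) • (v + star v)‖ ^ 2 ≤ 4 + 4 * m ^ 2 := by
  refine norm_sq_le_of_nonneg (star_hamiltonian u v m) (by positivity) ?_
  have hpi := Real.pi_pos
  have hs : 0 < Real.sin (Real.pi * θ) :=
    Real.sin_pos_of_pos_of_lt_pi (by nlinarith [hθ.1]) (by nlinarith [hθ.2])
  have hc : 0 ≤ Real.cos (Real.pi * θ) :=
    Real.cos_nonneg_of_mem_Icc ⟨by nlinarith [hθ.1], by nlinarith [hθ.2]⟩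
  have hcs : Real.cos (Real.pi * θ) ≤ Real.sin (Real.pi * θ) := by
    rw [← Real.cos_pi_div_two_sub]
    exact Real.cos_le_cos_of_nonneg_of_le_pi (by nlinarith [hθ.2]) (by nlinarith [hθ.2])
      (by nlinarith [hθ.1])
  -- c = cot(πθ) is the weight on xx* that exactly cancels the cross term in H²; the rest of s² +
  -- m²t² has weight 1 - c ≥ 0.
  obtain ⟨c, hc0, hc1, hce⟩ : ∃ c : ℝ, 0 ≤ c ∧ c ≤ 1 ∧
      Real.cos (Real.pi * θ) = c * Real.sin (Real.pi * θ) :=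
    ⟨_, div_nonneg hc hs.le, (div_le_one hs).2 hcs, (div_mul_cancel₀ _ hs.ne').symm⟩
  have h1 := ofReal_smul_nonneg hc0 (twoIm_mul_conj_nonneg u v m)
  have h2 := ofReal_smul_nonneg (sub_nonneg.2 hc1) (add_nonneg (twoIm_mul_self_nonneg u)
    (ofReal_smul_nonneg (sq_nonneg m) (twoIm_mul_self_nonneg v)))
  rw [h.twoIm_mul_conj] at h1
  rw [h.hamiltonian_mul_self, hce]
  convert add_nonneg h1 h2 using 1
  match_scalars <;> ring

theorem norm_sq_le_of_mem_Icc_zero_quarter (h : IsRotationPair θ u v)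
    (hθ : θ ∈ Set.Icc (0 : ℝ) (1 / 4)) (m : ℝ) :
    ‖u + star u + (m : ℂ) • (v + star v)‖ ^ 2 ≤ 4 + 4 * m ^ 2 + 8 * |m| *
      (Real.cos (Real.pi * θ) - Real.sin (Real.pi * θ)) * Real.cos (Real.pi * θ) := by
  have hpi := Real.pi_pos
  have hc : 0 ≤ Real.cos (Real.pi * θ) :=
    Real.cos_nonneg_of_mem_Icc ⟨by nlinarith [hθ.1], by nlinarith [hθ.2]⟩
  have hcs : 0 ≤ Real.cos (Real.pi * θ) - Real.sin (Real.pi * θ) := by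
    rw [← Real.cos_pi_div_two_sub, sub_nonneg]
    exact Real.cos_le_cos_of_nonneg_of_le_pi (by nlinarith [hθ.1]) (by nlinarith [hθ.1])
      (by nlinarith [hθ.2])
  refine norm_sq_le_of_nonneg (star_hamiltonian u v m) (by positivity) ?_
  have h1 := twoIm_mul_conj_nonneg u v m
  -- One full copy of xx* absorbs the sin part of the cross term. The remainder 2(cos - sin) mC is
  -- at most 2(cos - sin)|m|·4 cos, the extra term of the bound.
  have h2 := ofReal_smul_nonneg (mul_nonneg zero_le_two hcs)
    (sub_nonneg.2 (h.smul_cross_le (h.norm_cross_le hθ) m))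
  rw [h.twoIm_mul_conj] at h1
  rw [h.hamiltonian_mul_self]
  convert add_nonneg h1 h2 using 1
  match_scalars <;> ring

end Order

end IsRotationPair

theorem theorem2p1 (θ lam : ℝ) :
    (θ ∈ Set.Icc (1 / 4 : ℝ) (1 / 2) → ‖almostMathieu θ lam‖ ≤ Real.sqrt (4 + lam ^ 2)) ∧
    (θ ∈ Set.Icc (0 : ℝ) (1 / 4) →
      ‖almostMathieu θ lam‖ ^ 2 ≤ 4 + lam ^ 2 +
        4 * |lam| * (Real.cos (Real.pi * θ) - Real.sin (Real.pi * θ)) * Real.cos (Real.pi * θ)) := by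
  -- The order is only a tool: the claim concerns norms, so the spectral order is introduced
  -- locally.
  let _ : PartialOrder (RotationAlgebra θ) := CStarAlgebra.spectralOrder _
  let _ : StarOrderedRing (RotationAlgebra θ) := CStarAlgebra.spectralOrderedRing _
  have h := RotationAlgebra.isRotationPair_U_V θ
  constructor
  · intro hθ
    refine Real.le_sqrt_of_sq_le ((h.norm_sq_le_of_mem_Icc_quarter_half hθ (lam / 2)).trans_eq ?_)
    ring
  · intro hθ
    refine (h.norm_sq_le_of_mem_Icc_zero_quarter hθ (lam / 2)).trans_eq ?_
    rw [abs_div, abs_two]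
    ring
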